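/- A topological group is called monothetic if it contains an element that generates a dense cyclic subgroup. Every separable metrizable abelian topological group is topologically isomorphic to a subgroup, with the subspace topology, of a completely metrizable monothetic topological group. In particular, this holds for the additive group of every separable real or complex Banach space. -/

import Mathlib

universe u v

/-- A topological group (written additively) is monothetic if it has a single topological
generator: some element generates a dense cyclic subgroup. -/
def IsMonothetic (H : Type*) [AddGroup H] [TopologicalSpace H] : Prop :=
  ∃ h : H, Dense (AddSubgroup.zmultiples h : Set H)

/-- `G` is isomorphic, as a topological group, to a subgroup (with the subspace topology) of a
completely metrizable monothetic topological group `H`. -/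
def EmbedsInCompletelyMetrizableMonothetic (G : Type u) [AddCommGroup G]
    [TopologicalSpace G] : Prop :=
  ∃ (H : Type u) (_ : AddCommGroup H) (_ : TopologicalSpace H),
    IsTopologicalAddGroup H ∧ TopologicalSpace.IsCompletelyMetrizableSpace H ∧ IsMonothetic H ∧
      ∃ S : AddSubgroup H, Nonempty (G ≃ₜ+ S)

open Filter Topology TopologicalSpace UniformSpace

/-! Renorm `G` by a seminorm bounded by 1, then adjoin a generator `e` whose multiples `2 ^ k ^ 2 •
e` approximate a dense sequence of `G`, at cost `2⁻ᵏ` each. Combining approximations could shrink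
the norm on `G` only through an integer relation among the numbers `2 ^ k ^ 2`. These grow so fast
that every nontrivial relation costs at least 1 (`Finsupp.one_le_geometricSeminorm`), which no
element of `G` exceeds. Hence `G` embeds isometrically, and completing preserves the dense cyclic
subgroup. -/

/-- The topology of a first countable abelian topological group is induced by a bounded seminorm,
obtained from a pseudometric of its uniformity by taking the supremum over all translates. -/
theorem exists_addGroupSeminorm_le_one_inducing (G : Type*) [AddCommGroup G]
    [t : TopologicalSpace G] [IsTopologicalAddGroup G] [FirstCountableTopology G] :
    ∃ N : AddGroupSeminorm G, (∀ x, N x ≤ 1) ∧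
      N.toSeminormedAddCommGroup.toUniformSpace.toTopologicalSpace = t := by
  let : UniformSpace G := IsTopologicalAddGroup.rightUniformSpace G
  have : IsUniformAddGroup G := isUniformAddGroup_of_addCommGroup
  have : (uniformity G).IsCountablyGenerated := by
    rw [uniformity_eq_comap_nhds_zero]; infer_instance
  let : PseudoMetricSpace G := UniformSpace.pseudoMetricSpace G
  let f : G → G → ℝ := fun x g => min (dist g (x + g)) 1
  have hf0 : ∀ x g, 0 ≤ f x g := fun x g => le_min dist_nonneg zero_le_one
  have hf1 : ∀ x g, f x g ≤ 1 := fun x g => min_le_right _ _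
  have hbdd : ∀ x, BddAbove (Set.range (f x)) := fun x => ⟨1, by rintro _ ⟨g, rfl⟩; exact hf1 x g⟩
  have hfle : ∀ x g, f x g ≤ ⨆ g, f x g := fun x g => le_ciSup (hbdd x) g
  have hadd : ∀ x y g, f (x + y) g ≤ f x (y + g) + f y g := by
    intro x y g
    have h := dist_triangle g (y + g) (x + y + g)
    rw [add_assoc] at h
    have h1 := @dist_nonneg _ _ g (y + g)
    have h2 := @dist_nonneg _ _ (y + g) (x + (y + g))
    simp only [f, add_assoc]
    rcases min_cases (dist g (x + (y + g))) 1 with h3 | h3 <;>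
    rcases min_cases (dist (y + g) (x + (y + g))) 1 with h4 | h4 <;>
    rcases min_cases (dist g (y + g)) 1 with h5 | h5 <;> linarith
  have hneg : ∀ x g, f (-x) g = f x (-x + g) := by
    intro x g
    simp only [f, add_neg_cancel_left]
    rw [dist_comm]
  let N : AddGroupSeminorm G :=
    { toFun := fun x => ⨆ g, f x g
      map_zero' := by simp [f]
      add_le' := fun x y => ciSup_le fun g =>
        (hadd x y g).trans (add_le_add (hfle x _) (hfle y _))
      neg' := fun x => by
        simp only [hneg]
        exact (Equiv.addLeft (-x)).iSup_comp (g := f x) }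
  refine ⟨N, fun x => ciSup_le (hf1 x), ?_⟩
  refine IsTopologicalAddGroup.ext ?_ inferInstance ?_
  · let := N.toSeminormedAddCommGroup
    infer_instance
  have hN : (@nhds G N.toSeminormedAddCommGroup.toUniformSpace.toTopologicalSpace 0).HasBasis
      (fun ε : ℝ => 0 < ε) (fun ε => {x | N x < ε}) := by
    let := N.toSeminormedAddCommGroup
    exact NormedAddGroup.nhds_zero_basis_norm_lt
  refine hN.eq_of_same_basis ?_
  refine ⟨fun s => ⟨fun hs => ?_, ?_⟩⟩
  · obtain ⟨ε, hε, hs⟩ := Metric.mem_nhds_iff.1 hs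
    refine ⟨min ε 1, lt_min hε one_pos, fun x hx => hs ?_⟩
    have h : f x 0 < min ε 1 := (hfle x 0).trans_lt hx
    rw [Metric.mem_ball, dist_comm]
    simp only [f, add_zero] at h
    rcases min_cases (dist 0 x) 1 with h3 | h3
    · exact (h3.1 ▸ h).trans_le (min_le_left _ _)
    · exact absurd (h3.1 ▸ h) (by simp)
  · rintro ⟨ε, hε, hs⟩
    -- The uniformity is translation invariant, so one `V` serves all `g`; halving `ε` keeps the
    -- supremum strictly below it.
    have hu := Metric.dist_mem_uniformity (α := G) (half_pos hε)
    rw [uniformity_eq_comap_nhds_zero] at hu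
    obtain ⟨V, hV, hVs⟩ := hu
    refine mem_of_superset hV fun x hx => hs ?_
    refine lt_of_le_of_lt (ciSup_le fun g => ?_) (half_lt_self hε)
    have : (g, x + g) ∈ {p : G × G | dist p.1 p.2 < ε / 2} := hVs (by simpa using hx)
    exact (min_le_left _ _).trans (le_of_lt this)

/-- The weighted `ℓ¹` norm `∑ |aₖ| / 2ᵏ` on finitely supported integer sequences. -/
noncomputable def Finsupp.geometricSeminorm : AddGroupSeminorm (ℕ →₀ ℤ) where
  toFun a := a.sum fun k c => |(c : ℝ)| * (1 / 2) ^ k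
  map_zero' := by simp
  add_le' a b := by
    rw [Finsupp.sum_of_support_subset (a + b) Finsupp.support_add _ (by simp),
      Finsupp.sum_of_support_subset a Finset.subset_union_left _ (by simp),
      Finsupp.sum_of_support_subset b Finset.subset_union_right _ (by simp),
      ← Finset.sum_add_distrib]
    refine Finset.sum_le_sum fun k _ => ?_
    rw [← add_mul]
    gcongr
    simpa using abs_add_le (a k : ℝ) (b k)
  neg' a := by simp [Finsupp.sum]

theorem Finsupp.geometricSeminorm_apply (a : ℕ →₀ ℤ) :
    Finsupp.geometricSeminorm a = a.sum fun k c => |(c : ℝ)| * (1 / 2) ^ k := rfl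

theorem Finsupp.geometricSeminorm_single (k : ℕ) (c : ℤ) :
    Finsupp.geometricSeminorm (Finsupp.single k c) = |(c : ℝ)| * (1 / 2) ^ k := by
  simp [Finsupp.geometricSeminorm_apply]

/-- A nontrivial integer relation between the numbers `2 ^ k ^ 2` has large coefficients. -/
theorem Finsupp.one_le_geometricSeminorm {a : ℕ →₀ ℤ} (ha : a ≠ 0)
    (h : (a.sum fun k c => c * (2 : ℤ) ^ k ^ 2) = 0) : 1 ≤ Finsupp.geometricSeminorm a := by
  obtain ⟨K, hK, hmax⟩ := a.support.exists_max_image id (Finsupp.support_nonempty_iff.2 ha)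
  have hsum : (∑ k ∈ a.support, (a k : ℝ) * 2 ^ k ^ 2) = 0 := by
    have := congrArg (Int.cast : ℤ → ℝ) h
    simpa [Finsupp.sum] using this
  rw [← Finset.add_sum_erase _ _ hK] at hsum
  have hKle : (2 : ℝ) ^ K ^ 2 ≤ |(a K : ℝ) * 2 ^ K ^ 2| := by
    rw [abs_mul, abs_of_pos (by positivity : (0 : ℝ) < 2 ^ K ^ 2)]
    refine le_mul_of_one_le_left (by positivity) ?_
    exact_mod_cast Int.one_le_abs (Finsupp.mem_support_iff.1 hK)
  have hterm : ∀ k ∈ a.support.erase K,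
      |(a k : ℝ) * 2 ^ k ^ 2| ≤ |(a k : ℝ)| * (1 / 2) ^ k * 2 ^ K ^ 2 := by
    intro k hk
    have hkK : k + 1 ≤ K :=
      lt_of_le_of_ne (hmax k (Finset.mem_of_mem_erase hk)) (Finset.ne_of_mem_erase hk)
    rw [abs_mul, abs_of_pos (by positivity : (0 : ℝ) < 2 ^ k ^ 2), mul_assoc]
    gcongr
    -- From `k < K`, `k ^ 2 + k ≤ K ^ 2`: the gap between squares absorbs the weight `2⁻ᵏ`.
    have h2 : (2 : ℝ) ^ k ^ 2 * 2 ^ k ≤ 2 ^ K ^ 2 := by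
      rw [← pow_add]
      exact pow_le_pow_right₀ one_le_two (by nlinarith)
    calc (2 : ℝ) ^ k ^ 2 = (1 / 2) ^ k * (2 ^ k ^ 2 * 2 ^ k) := by
          rw [mul_comm ((2 : ℝ) ^ k ^ 2), ← mul_assoc, ← mul_pow]; norm_num
      _ ≤ _ := by gcongr
  have hle : (2 : ℝ) ^ K ^ 2 ≤ Finsupp.geometricSeminorm a * 2 ^ K ^ 2 :=
    calc (2 : ℝ) ^ K ^ 2 ≤ |(a K : ℝ) * 2 ^ K ^ 2| := hKle
      _ = |∑ k ∈ a.support.erase K, (a k : ℝ) * 2 ^ k ^ 2| := by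
          rw [eq_neg_of_add_eq_zero_left hsum, abs_neg]
      _ ≤ ∑ k ∈ a.support.erase K, |(a k : ℝ) * 2 ^ k ^ 2| := Finset.abs_sum_le_sum_abs _ _
      _ ≤ ∑ k ∈ a.support.erase K, |(a k : ℝ)| * (1 / 2) ^ k * 2 ^ K ^ 2 :=
          Finset.sum_le_sum hterm
      _ ≤ ∑ k ∈ a.support, |(a k : ℝ)| * (1 / 2) ^ k * 2 ^ K ^ 2 :=
          Finset.sum_le_sum_of_subset_of_nonneg (Finset.erase_subset _ _)
            fun _ _ _ => by positivity
      _ = Finsupp.geometricSeminorm a * 2 ^ K ^ 2 := by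
          rw [← Finset.sum_mul]; rfl
  exact le_of_mul_le_mul_right (by simpa using hle) (by positivity : (0 : ℝ) < 2 ^ K ^ 2)

/-- A separable abelian group with a bounded seminorm embeds isometrically into a monothetic
seminormed group: adjoin a generator `e`, and force `2 ^ k ^ 2 • e` to be `2⁻ᵏ`-close to the
`k`-th term of a sequence that visits each point of a dense sequence infinitely often. -/
theorem exists_isometry_isMonothetic (G : Type u) [SeminormedAddCommGroup G]
    [SeparableSpace G] (hG : ∀ x : G, ‖x‖ ≤ 1) :
    ∃ (H : Type u) (_ : SeminormedAddCommGroup H) (j : G →+ H), Isometry j ∧ IsMonothetic H := by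
  let : SeminormedAddCommGroup (ℕ →₀ ℤ) :=
    Finsupp.geometricSeminorm.toSeminormedAddCommGroup
  let g : ℕ → G := fun k => denseSeq G k.unpair.1
  let s : (ℕ →₀ ℤ) →+ G := Finsupp.liftAddHom fun k => zmultiplesHom G (g k)
  let n : (ℕ →₀ ℤ) →+ ℤ := Finsupp.liftAddHom fun k => AddMonoidHom.mulRight ((2 : ℤ) ^ k ^ 2)
  have hn : ∀ a : ℕ →₀ ℤ, n a = a.sum fun k c => c * (2 : ℤ) ^ k ^ 2 := fun a => rfl
  -- Modulo `φ.ker` the group is algebraically `G × ℤ`; only its quotient seminorm is new.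
  let φ : G × (ℕ →₀ ℤ) →+ G × ℤ := (AddMonoidHom.fst _ _ - s.comp (AddMonoidHom.snd _ _)).prod
    (n.comp (AddMonoidHom.snd _ _))
  have hφ : ∀ x a, φ (x, a) = (x - s a, n a) := fun x a => rfl
  let q : G × (ℕ →₀ ℤ) →+ (G × (ℕ →₀ ℤ)) ⧸ φ.ker := QuotientAddGroup.mk' φ.ker
  have hq : ∀ x y, φ x = φ y → q x = q y := fun x y h => by
    rw [← sub_eq_zero, ← map_sub, QuotientAddGroup.mk'_apply, QuotientAddGroup.eq_zero_iff,
      AddMonoidHom.mem_ker, map_sub, h, sub_self]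
  have hs : ∀ k c, s (Finsupp.single k c) = c • g k := fun k c => by simp [s]
  have hns : ∀ k c, n (Finsupp.single k c) = c * 2 ^ k ^ 2 := fun k c => by simp [n]
  let j : G →+ (G × (ℕ →₀ ℤ)) ⧸ φ.ker := q.comp (AddMonoidHom.inl _ _)
  have hj : Isometry j := by
    refine AddMonoidHomClass.isometry_of_norm j fun x => le_antisymm ?_ ?_
    · refine QuotientAddGroup.norm_mk_le_norm.trans_eq ?_
      simp [Prod.norm_def]
    · refine QuotientAddGroup.le_norm_iff.2 fun ⟨y, a⟩ h => ?_
      have h' : φ (y, a) = φ (x, 0) := by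
        have h0 : q (y, a) - q (x, 0) = 0 := sub_eq_zero.2 h
        rw [← map_sub, QuotientAddGroup.mk'_apply, QuotientAddGroup.eq_zero_iff,
          AddMonoidHom.mem_ker, map_sub] at h0
        exact sub_eq_zero.1 h0
      simp only [hφ, map_zero, sub_zero, Prod.mk.injEq] at h'
      by_cases ha : a = 0
      · subst ha
        have : y = x := by simpa using h'.1
        rw [this]
        exact le_max_left _ _
      · exact (hG x).trans ((Finsupp.one_le_geometricSeminorm ha (hn a ▸ h'.2)).trans
          (le_max_right _ _))
  refine ⟨(G × (ℕ →₀ ℤ)) ⧸ φ.ker, inferInstance, j, hj, ?_⟩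
  -- `φ` sends this pair to `(0, 1)`, since `2 ^ 0 ^ 2 = 1`.
  let e := q (g 0, Finsupp.single 0 1)
  let C := (AddSubgroup.zmultiples e).topologicalClosure
  have he : e ∈ C := AddSubgroup.le_topologicalClosure _ (AddSubgroup.mem_zmultiples e)
  have hrel : ∀ k, j (g k) - q (0, -Finsupp.single k 1) = (2 : ℤ) ^ k ^ 2 • e := fun k => by
    rw [← map_zsmul]
    change q _ - q _ = _
    rw [← map_sub]
    apply hq
    simp [hφ, hs, hns]
  have hdense : ∀ i, j (denseSeq G i) ∈ C := by
    intro i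
    refine mem_closure_of_tendsto (f := fun m : ℕ => (2 : ℤ) ^ (Nat.pair i m) ^ 2 • e)
      (b := atTop) ?_ (Eventually.of_forall fun m =>
        AddSubgroup.zsmul_mem _ (AddSubgroup.mem_zmultiples e) _)
    rw [tendsto_iff_norm_sub_tendsto_zero]
    refine squeeze_zero (fun _ => norm_nonneg _) (fun m => ?_)
      (tendsto_pow_atTop_nhds_zero_of_lt_one (r := (1 / 2 : ℝ)) (by norm_num) (by norm_num))
    rw [← hrel]
    have : g (Nat.pair i m) = denseSeq G i := by simp [g]
    rw [this, sub_sub_cancel_left, norm_neg]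
    refine QuotientAddGroup.norm_mk_le_norm.trans ?_
    rw [Prod.norm_def, norm_neg, norm_zero]
    refine max_le (by positivity) ?_
    refine (Finsupp.geometricSeminorm_single _ _).trans_le ?_
    simpa using pow_le_pow_of_le_one (a := (1 / 2 : ℝ)) (by norm_num) (by norm_num)
      (Nat.right_le_pair i m)
  have hjC : ∀ x, j x ∈ C := by
    have hcl : IsClosed (j ⁻¹' (C : Set _)) :=
      (AddSubgroup.isClosed_topologicalClosure _).preimage hj.continuous
    intro x
    have := (denseRange_denseSeq G).closure_eq ▸ Set.mem_univ x
    exact hcl.closure_subset_iff.2 (Set.range_subset_iff.2 hdense) this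
  refine ⟨e, fun z => ?_⟩
  change z ∈ C
  obtain ⟨⟨x, a⟩, rfl⟩ := QuotientAddGroup.mk'_surjective _ z
  have : q (x, a) = j (x - s a) + n a • e := by
    rw [← map_zsmul]
    change _ = q _ + q _
    rw [← map_add]
    apply hq
    simp [hφ, hs, hns]
  change q (x, a) ∈ C
  rw [this]
  exact C.add_mem (hjC _) (C.zsmul_mem he _)

theorem IsMonothetic.of_denseRange {H K : Type*} [AddGroup H] [TopologicalSpace H] [AddGroup K]
    [TopologicalSpace K] (hH : IsMonothetic H) (f : H →+ K) (hf : Continuous f)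
    (hd : DenseRange f) : IsMonothetic K := by
  obtain ⟨e, he⟩ := hH
  refine ⟨f e, ?_⟩
  rw [← AddMonoidHom.map_zmultiples, AddSubgroup.coe_map]
  exact hd.dense_image hf he

theorem embedsInCompletelyMetrizableMonothetic_of_separable_metrizable (G : Type u)
    [AddCommGroup G] [t : TopologicalSpace G] [IsTopologicalAddGroup G] [SeparableSpace G]
    [MetrizableSpace G] : EmbedsInCompletelyMetrizableMonothetic G := by
  obtain ⟨N, hN, hNt⟩ := exists_addGroupSeminorm_le_one_inducing G
  let : SeminormedAddCommGroup G := N.toSeminormedAddCommGroup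
  subst hNt
  obtain ⟨H, _, j, hj, hH⟩ := exists_isometry_isMonothetic G hN
  let i : G →+ Completion H := Completion.toCompl.comp j
  -- `H` need not be Hausdorff; injectivity comes from `G` being T0.
  have hi : IsEmbedding i :=
    (Completion.coe_isometry.comp hj).isUniformInducing.isInducing.isEmbedding
  refine ⟨Completion H, inferInstance, inferInstance, inferInstance, inferInstance,
    hH.of_denseRange Completion.toCompl (Completion.continuous_coe H) Completion.denseRange_coe,
    i.range, ⟨?_⟩⟩
  let f := AddMonoidHom.ofInjective hi.injective
  exact { f, f.toEquiv.toHomeomorphOfIsInducing hi.toHomeomorph.isInducing with }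

theorem theorem1p3 :
    (∀ (G : Type u) [AddCommGroup G] [TopologicalSpace G] [IsTopologicalAddGroup G]
        [TopologicalSpace.SeparableSpace G] [TopologicalSpace.MetrizableSpace G],
      EmbedsInCompletelyMetrizableMonothetic G) ∧
    (∀ (𝕜 : Type v) [RCLike 𝕜] (E : Type u) [NormedAddCommGroup E] [NormedSpace 𝕜 E]
        [CompleteSpace E] [TopologicalSpace.SeparableSpace E],
      EmbedsInCompletelyMetrizableMonothetic E) :=
  ⟨fun G => embedsInCompletelyMetrizableMonothetic_of_separable_metrizable G,
    fun _ _ E => embedsInCompletelyMetrizableMonothetic_of_separable_metrizable E⟩
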